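/- Let $\mathfrak N=\mathbb C\times\mathbb R$ be the Heisenberg group, with group law $(\zeta_1,v_1)\cdot(\zeta_2,v_2)=(\zeta_1+\zeta_2,\;v_1+v_2+2\operatorname{Im}(\zeta_1\bar\zeta_2))$, and let $\mathrm{SU}(2,1)$ be the group of complex $3\times 3$ matrices of determinant $1$ preserving the Hermitian form $\langle \mathbf z,\mathbf w\rangle=\bar w_3z_1+\bar w_2z_2+\bar w_1z_3$. Let $(s_1e^{i\theta_1},t_1)$ and $(s_2e^{i\theta_2},t_2)$ be non-trivial elements of $\mathfrak N$, where $s_j\ge 0$ and $\theta_j,t_j\in\mathbb R$ (if $s_j=0$, then $\theta_j$ may be any real number subject to the condition below). Let $$A=\begin{pmatrix}1&-\sqrt2\,s_1e^{-i\theta_1}&-s_1^2+it_1\\0&1&\sqrt2\,s_1e^{i\theta_1}\\0&0&1\end{pmatrix},\qquad B=\begin{pmatrix}1&0&0\\\sqrt2\,s_2e^{i\theta_2}&1&0\\-s_2^2+it_2&-\sqrt2\,s_2e^{-i\theta_2}&1\end{pmatrix}$$ be the associated Heisenberg translations in $\mathrm{SU}(2,1)$. Suppose that $-\pi/2\le\theta_1-\theta_2\le\pi/2$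 (this can always be arranged by replacing one of $A$, $B$ by its inverse if necessary). Suppose that at least one of the following three conditions holds: (1') $|s_1^2+it_1|^{1/2}\,|s_2^2+it_2|^{1/2}\ge 4$; (2') $s_1\ne 0$ and $s_1\,|s_2^2+it_2|^{1/2}\ge 4\cos^2\bigl((\theta_1-\theta_2)/2\bigr)$; (3') $s_2\ne 0$ and $|s_1^2+it_1|^{1/2}\,s_2\ge 4\cos^2\bigl((\theta_1-\theta_2)/2\bigr)$. Then the subgroup $\langle A,B\rangle$ of $\mathrm{SU}(2,1)$ is discrete, and it is freely generated by $A$ and $B$. -/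

import Mathlib

open scoped Matrix ComplexConjugate

/-- The Heisenberg group: the set `ℂ × ℝ` of pairs `(ζ, v)`. -/
@[ext]
structure Heisenberg where
  /-- the vertical projection `ζ` -/
  ζ : ℂ
  /-- the vertical coordinate `v` -/
  v : ℝ

namespace Heisenberg

/-- The group law `(ζ₁, v₁) (ζ₂, v₂) = (ζ₁ + ζ₂, v₁ + v₂ + 2 Im (ζ₁ conj ζ₂))`. -/
instance : Mul Heisenberg where
  mul p q := ⟨p.ζ + q.ζ, p.v + q.v + 2 * (p.ζ * conj q.ζ).im⟩

instance : One Heisenberg where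
  one := ⟨0, 0⟩

instance : Inv Heisenberg where
  inv p := ⟨-p.ζ, -p.v⟩

theorem mul_def (p q : Heisenberg) :
    p * q = ⟨p.ζ + q.ζ, p.v + q.v + 2 * (p.ζ * conj q.ζ).im⟩ := rfl

theorem one_def : (1 : Heisenberg) = ⟨0, 0⟩ := rfl

theorem inv_def (p : Heisenberg) : p⁻¹ = ⟨-p.ζ, -p.v⟩ := rfl

instance : Group Heisenberg :=
  Group.ofLeftAxioms
    (by
      intro p q r
      simp only [mul_def, Heisenberg.mk.injEq]
      refine ⟨by ring, ?_⟩
      simp only [Complex.mul_im, Complex.conj_re, Complex.conj_im, Complex.add_re, Complex.add_im]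
      ring)
    (by
      intro p
      simp [mul_def, one_def])
    (by
      intro p
      simp only [mul_def, one_def, inv_def, Heisenberg.mk.injEq]
      refine ⟨by ring, ?_⟩
      simp only [Complex.mul_im, Complex.conj_re, Complex.conj_im, Complex.neg_re, Complex.neg_im]
      ring)

/-- The element `(s e^{iθ}, t)` of the Heisenberg group. -/
noncomputable def polar (s θ t : ℝ) : Heisenberg :=
  ⟨(s : ℂ) * Complex.exp ((θ : ℂ) * Complex.I), t⟩

end Heisenberg

/-- The matrix of the Hermitian form of signature `(2, 1)` on `ℂ³`,
`⟨z, w⟩ = w* H z = conj w₃ z₁ + conj w₂ z₂ + conj w₁ z₃`. -/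
def hermitianH : Matrix (Fin 3) (Fin 3) ℂ :=
  !![0, 0, 1; 0, 1, 0; 1, 0, 0]

/-- The group `SU(2,1)`: the matrices of determinant one that preserve the Hermitian form,
with the topology of entrywise convergence (inherited from `SL(3, ℂ)`). -/
def SU21 : Subgroup (Matrix.SpecialLinearGroup (Fin 3) ℂ) where
  carrier := {g | (g : Matrix (Fin 3) (Fin 3) ℂ)ᴴ * hermitianH
    * (g : Matrix (Fin 3) (Fin 3) ℂ) = hermitianH}
  one_mem' := by simp
  mul_mem' := by
    intro a b ha hb
    simp only [Set.mem_ofPred_eq, Matrix.SpecialLinearGroup.coe_mul,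
      Matrix.conjTranspose_mul] at *
    calc _ = (b : Matrix (Fin 3) (Fin 3) ℂ)ᴴ * ((a : Matrix (Fin 3) (Fin 3) ℂ)ᴴ * hermitianH
            * (a : Matrix (Fin 3) (Fin 3) ℂ)) * (b : Matrix (Fin 3) (Fin 3) ℂ) := by
          simp only [Matrix.mul_assoc]
      _ = hermitianH := by rw [ha, hb]
  inv_mem' := by
    intro a ha
    simp only [Set.mem_ofPred_eq] at *
    have h : (a : Matrix (Fin 3) (Fin 3) ℂ) * ((a⁻¹ : Matrix.SpecialLinearGroup (Fin 3) ℂ) :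
        Matrix (Fin 3) (Fin 3) ℂ) = 1 := by
      rw [← Matrix.SpecialLinearGroup.coe_mul, mul_inv_cancel, Matrix.SpecialLinearGroup.coe_one]
    set b := ((a⁻¹ : Matrix.SpecialLinearGroup (Fin 3) ℂ) : Matrix (Fin 3) (Fin 3) ℂ)
    calc bᴴ * hermitianH * b
        = bᴴ * ((a : Matrix (Fin 3) (Fin 3) ℂ)ᴴ * hermitianH
            * (a : Matrix (Fin 3) (Fin 3) ℂ)) * b := by rw [ha]
      _ = ((a : Matrix (Fin 3) (Fin 3) ℂ) * b)ᴴ * hermitianH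
            * ((a : Matrix (Fin 3) (Fin 3) ℂ) * b) := by
          simp only [Matrix.mul_assoc, Matrix.conjTranspose_mul]
      _ = hermitianH := by rw [h]; simp

/-- The matrix of the Heisenberg translation by `(s e^{iθ}, t)` fixing `∞`. -/
noncomputable def matrixA (s θ t : ℝ) : Matrix (Fin 3) (Fin 3) ℂ :=
  !![1, -(√2 : ℂ) * s * Complex.exp (-(θ * Complex.I)), -(s : ℂ) ^ 2 + t * Complex.I;
     0, 1, (√2 : ℂ) * s * Complex.exp (θ * Complex.I);
     0, 0, 1]

/-- The matrix of the Heisenberg translation associated with `(s e^{iθ}, t)` fixing the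
origin `o`. -/
noncomputable def matrixB (s θ t : ℝ) : Matrix (Fin 3) (Fin 3) ℂ :=
  !![1, 0, 0;
     (√2 : ℂ) * s * Complex.exp (θ * Complex.I), 1, 0;
     -(s : ℂ) ^ 2 + t * Complex.I, -(√2 : ℂ) * s * Complex.exp (-(θ * Complex.I)), 1]

theorem det_matrixA (s θ t : ℝ) : (matrixA s θ t).det = 1 := by
  simp [matrixA, Matrix.det_fin_three]

theorem det_matrixB (s θ t : ℝ) : (matrixB s θ t).det = 1 := by
  simp [matrixB, Matrix.det_fin_three]

theorem sqrt_two_mul_exp (s θ : ℝ) :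
    (√2 : ℂ) * s * Complex.exp (-(θ * Complex.I)) * ((√2 : ℂ) * s * Complex.exp (θ * Complex.I))
      = 2 * (s : ℂ) ^ 2 := by
  have h1 : Complex.exp (-(θ * Complex.I)) * Complex.exp (θ * Complex.I) = 1 := by
    rw [← Complex.exp_add]; simp
  have h2 : (√2 : ℂ) * (√2 : ℂ) = 2 := by
    rw [← Complex.ofReal_mul]; simp
  linear_combination (√2 : ℂ) * (√2 : ℂ) * (s : ℂ) ^ 2 * h1 + (s : ℂ) ^ 2 * h2

theorem conj_exp_mul_I (θ : ℝ) :
    conj (Complex.exp (θ * Complex.I)) = Complex.exp (-(θ * Complex.I)) := by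
  rw [← Complex.exp_conj]; simp

theorem conj_exp_neg_mul_I (θ : ℝ) :
    conj (Complex.exp (-(θ * Complex.I))) = Complex.exp (θ * Complex.I) := by
  rw [← Complex.exp_conj]; simp

theorem matrixA_unitary (s θ t : ℝ) :
    (matrixA s θ t)ᴴ * hermitianH * matrixA s θ t = hermitianH := by
  have h := sqrt_two_mul_exp s θ
  ext i j
  fin_cases i <;> fin_cases j <;>
    simp [matrixA, hermitianH, Matrix.mul_apply, Fin.sum_univ_three, conj_exp_mul_I,
      conj_exp_neg_mul_I]
  linear_combination h

theorem matrixB_unitary (s θ t : ℝ) :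
    (matrixB s θ t)ᴴ * hermitianH * matrixB s θ t = hermitianH := by
  have h := sqrt_two_mul_exp s θ
  ext i j
  fin_cases i <;> fin_cases j <;>
    simp [matrixB, hermitianH, Matrix.mul_apply, Fin.sum_univ_three, conj_exp_mul_I,
      conj_exp_neg_mul_I]
  linear_combination h

/-- The Heisenberg translation `A` as an element of `SU(2,1)`. -/
noncomputable def translationA (s θ t : ℝ) : SU21 :=
  ⟨⟨matrixA s θ t, det_matrixA s θ t⟩, matrixA_unitary s θ t⟩

/-- The Heisenberg translation `B` as an element of `SU(2,1)`. -/
noncomputable def translationB (s θ t : ℝ) : SU21 :=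
  ⟨⟨matrixB s θ t, det_matrixB s θ t⟩, matrixB_unitary s θ t⟩

/-!
The group plays ping-pong on the null vectors of the Hermitian form, that is, on the boundary of
complex hyperbolic space: there are disjoint open sets `U`, `V` such that every nontrivial power of
`A` maps `U` into `V` and every nontrivial power of `B` maps `V` into `U`. Freeness is then the
ping-pong lemma. Discreteness follows as well (`eventually_eq_one_of_ping_pong`): a word whose first
and last letters lie in the same factor moves a chosen point of `U` or `V` into the other set, so it
stays away from the identity, and any other nontrivial word becomes such a word after conjugation by
one of finitely many letters.

Under the first condition `U` is a Cygan ball about the fixed point `o` of `B`, and `V` is its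
exterior (`hasPingPong_of_ball`). By the triangle inequality for the Cygan norm (`cygan_lt`), `A`
moves a ball of radius `r` off itself if its Cygan translation length is at least `2 r`; the same
estimate applies to `B` and the exterior after the inversion that swaps `o` and `∞`.

Under the second condition `U` is the set of points over a strip of width `s₁` in `ℂ`, perpendicular
to the translation direction of `A`, so that powers of `A` move it off itself
(`hasPingPong_of_strip`). Powers of `B` map the exterior of their isometric spheres into the
isometric spheres of their inverses, so it suffices that the isometric spheres of all `B ^ n`,
`n ≠ 0`, lie over the strip. The isometric sphere of `B ^ n` projects into a disc with explicit centre
and radius (`isometric_disc`). The strip is centred so that `B` and `B⁻¹` have symmetric discs, and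
an elementary estimate (`isometric_offset_le`) shows that the discs of all other powers fit.

The third condition is the second one with the roles of `A` and `B` exchanged
(`HasPingPong.symm`).
-/

/-! ### Ping-pong and discreteness -/

section PingPong

open Monoid.CoprodI Topology
open scoped Pointwise Function

/-- The dynamical form of the ping-pong lemma that also yields discreteness. If the factors `H i`
play ping-pong on sets `X i` from which no point is moved out by elements close to the identity,
then the identity is isolated in the group generated by the factors. -/
theorem eventually_eq_one_of_ping_pong {ι : Type*} [Finite ι] [Nontrivial ι] {H : ι → Type*}
    [∀ i, Group (H i)] {G : Type*} [Group G] [TopologicalSpace G] [IsTopologicalGroup G]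
    (f : ∀ i, H i →* G) (hcard : ∀ i, 3 ≤ Cardinal.mk (H i))
    {α : Type*} [MulAction G α] (X : ι → Set α) (hXnonempty : ∀ i, (X i).Nonempty)
    (hXdisj : Pairwise (Disjoint on X))
    (hpp : Pairwise fun i j => ∀ h : H i, h ≠ 1 → f i h • X j ⊆ X i)
    (hopen : ∀ i, ∀ x ∈ X i, ∀ᶠ g in 𝓝 (1 : G), g • x ∈ X i) :
    ∀ᶠ g in 𝓝 (1 : G), g ∈ (lift f).range → g = 1 := by
  classical
  choose x hx using hXnonempty
  -- An element close to `1` keeps each `x k` in `X k`, so it is not given by a word whose first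
  -- and last letters lie in the same factor.
  have hW : ∀ᶠ g in 𝓝 (1 : G), ∀ k, g • x k ∈ X k :=
    Filter.eventually_all.2 fun k => hopen k _ (hx k)
  have hne : ∀ g : G, (∀ k, g • x k ∈ X k) → ∀ i, ∀ w : NeWord H i i, lift f w.prod ≠ g := by
    rintro g hg i w rfl
    obtain ⟨k, hk⟩ := exists_ne i
    have hmem : lift f w.prod • x k ∈ X i :=
      lift_word_ping_pong f X hpp w hk.symm (Set.smul_mem_smul_set (hx k))
    exact (hXdisj hk).le_bot ⟨hg k, hmem⟩
  have htwo : ∀ i, ∃ h h' : H i, h ≠ 1 ∧ h' ≠ 1 ∧ h ≠ h' := by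
    intro i
    obtain ⟨h, h1, -⟩ := Cardinal.exists_ne_ne_of_three_le (hcard i) 1 1
    obtain ⟨h', h1', h2⟩ := Cardinal.exists_ne_ne_of_three_le (hcard i) 1 h
    exact ⟨h, h', h1, h1', h2.symm⟩
  choose h h' h1 h1' hhh using htwo
  have hconj : ∀ c : G, ∀ᶠ g in 𝓝 (1 : G), ∀ k, (c * g * c⁻¹) • x k ∈ X k := by
    intro c
    have hc : Filter.Tendsto (fun g : G => c * g * c⁻¹) (𝓝 1) (𝓝 1) := by
      have : Continuous fun g : G => c * g * c⁻¹ := by fun_prop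
      simpa using this.tendsto 1
    exact hc.eventually hW
  filter_upwards [hW, Filter.eventually_all.2 fun i => hconj (f i (h i)),
    Filter.eventually_all.2 fun i => hconj (f i (h' i))] with g hg hg1 hg2
  rintro ⟨y, rfl⟩
  by_contra hy
  have hw0 : Word.equiv y ≠ Word.empty := by
    intro hw
    apply hy
    have : y = 1 := by
      rw [← Word.equiv.symm_apply_apply y, hw]
      exact Word.prod_empty
    rw [this, map_one]
  obtain ⟨i, j, w, hw⟩ := NeWord.of_word _ hw0
  have hwy : w.prod = y := by
    rw [NeWord.prod, hw]
    exact Word.equiv.symm_apply_apply y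
  rcases eq_or_ne i j with rfl | hij
  · exact hne _ hg i w (by rw [hwy])
  · -- Conjugation by a letter that does not cancel the first one closes the word up.
    have key : ∀ c : H i, c ≠ 1 → c * w.head ≠ 1 →
        ¬ ∀ k, (f i c * lift f y * (f i c)⁻¹) • x k ∈ X k := by
      intro c hc hcw hk
      refine hne _ hk i (NeWord.append (NeWord.mulHead w c hcw) hij.symm
        (NeWord.singleton c⁻¹ (inv_ne_one.mpr hc))) ?_
      simp [hwy]
    by_cases hc : h i * w.head = 1
    · refine key (h' i) (h1' i) (fun hc' => hhh i ?_) (hg2 i)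
      exact mul_right_cancel (hc.trans hc'.symm)
    · exact key (h i) (h1 i) hc (hg1 i)

/-- Ping-pong for cyclic groups: if all nontrivial powers of `a i` map `X j` into `X i` for
`j ≠ i`, and no point leaves its set under elements close to the identity, then the `a i` freely
generate a discrete group. -/
theorem discrete_and_free_of_ping_pong {ι : Type*} [Finite ι] [Nontrivial ι]
    {G : Type*} [Group G] [TopologicalSpace G] [IsTopologicalGroup G] (a : ι → G)
    {α : Type*} [MulAction G α] (X : ι → Set α) (hXnonempty : ∀ i, (X i).Nonempty)
    (hXdisj : Pairwise (Disjoint on X))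
    (hpp : Pairwise fun i j => ∀ n : ℤ, n ≠ 0 → ∀ x ∈ X j, a i ^ n • x ∈ X i)
    (hopen : ∀ i, ∀ x ∈ X i, ∀ᶠ g in 𝓝 (1 : G), g • x ∈ X i) :
    DiscreteTopology (Subgroup.closure (Set.range a)) ∧
      Function.Injective (FreeGroup.lift a) := by
  let f : ∀ _ : ι, FreeGroup Unit →* G := fun i => FreeGroup.lift fun _ => a i
  have hlift : FreeGroup.lift a = (lift f).comp (@freeGroupEquivCoprodI ι).toMonoidHom := by
    ext i
    simp [f]
  have hcard : ∀ _ : ι, 3 ≤ Cardinal.mk (FreeGroup Unit) := by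
    intro _
    rw [FreeGroup.freeGroupUnitEquivInt.cardinal_eq, Cardinal.mk_denumerable]
    exact Cardinal.natCast_le_aleph0
  have hpp' : Pairwise fun i j => ∀ h : FreeGroup Unit, h ≠ 1 → f i h • X j ⊆ X i := by
    rintro i j hij
    refine FreeGroup.freeGroupUnitEquivInt.forall_congr_left.mpr ?_
    intro n hn
    rintro _ ⟨x, hx, rfl⟩
    have hfn : f i (FreeGroup.freeGroupUnitEquivInt.symm n) = a i ^ n := by
      change FreeGroup.lift (fun _ => a i) (FreeGroup.of () ^ n) = a i ^ n
      simp
    have hn0 : n ≠ 0 := by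
      rintro rfl
      apply hn
      simp [FreeGroup.freeGroupUnitEquivInt]
    simp only [hfn]
    exact hpp hij n hn0 x hx
  constructor
  · have hrange : Subgroup.closure (Set.range a) = (lift f).range := by
      rw [← FreeGroup.range_lift_eq_closure, hlift]
      rw [MonoidHom.range_comp, MonoidHom.range_eq_top.2 (MulEquiv.surjective _),
        ← MonoidHom.range_eq_map]
    have hev := eventually_eq_one_of_ping_pong f hcard X hXnonempty hXdisj hpp' hopen
    rw [hrange]
    refine discreteTopology_of_isOpen_singleton_one ?_
    rw [isOpen_singleton_iff_nhds_eq_pure, ← Filter.principal_singleton]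
    refine le_antisymm ?_ (by simpa using pure_le_nhds (1 : (lift f).range))
    rw [Filter.le_principal_iff]
    have hc : Filter.Tendsto (Subtype.val : (lift f).range → G) (𝓝 1) (𝓝 1) :=
      continuous_subtype_val.tendsto' _ _ rfl
    filter_upwards [hc.eventually hev] with g hg
    exact Subtype.ext (hg g.2)
  · rw [hlift, MonoidHom.coe_comp]
    refine Function.Injective.comp ?_ (MulEquiv.injective _)
    exact lift_injective_of_ping_pong f
      (Or.inr ⟨Classical.arbitrary ι, hcard (Classical.arbitrary ι)⟩) X hXnonempty hXdisj hpp'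

end PingPong

/-! ### The extremal estimate for isometric spheres -/

/-- The extremal estimate behind the strip. In units where the Cygan norm of the translation of `B`
is `1`, with `x = s`, `S = t` and `(a, b)` the direction of the translation, the isometric sphere of
`B ^ n` projects to a disc whose centre has offset `x * (n * x ^ 2 * a + S * b) / Q` along the
translation direction of `A` and whose radius is `u`. The bound `1 + a` holds for all `n ≠ 0` about
the common axis `x * S * b`, the midpoint of the centres for `n = 1` and `n = -1`. -/
theorem isometric_offset_le {x S a b u : ℝ} {n : ℤ} (hn : n ≠ 0) (hx : 0 ≤ x)
    (hxS : x ^ 4 + S ^ 2 = 1) (ha : 0 ≤ a) (hab : a ^ 2 + b ^ 2 = 1) (hu : 0 ≤ u)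
    (huQ : u ^ 4 * ((n : ℝ) ^ 2 * ((n : ℝ) ^ 2 * x ^ 4 + S ^ 2)) = 1) :
    |x * (n * x ^ 2 * a + S * b) / ((n : ℝ) ^ 2 * x ^ 4 + S ^ 2) - x * S * b| + u ≤ 1 + a := by
  set Q : ℝ := (n : ℝ) ^ 2 * x ^ 4 + S ^ 2 with hQ
  have hn1 : (1 : ℝ) ≤ |(n : ℝ)| := by exact_mod_cast Int.one_le_abs hn
  have hn2 : (1 : ℝ) ≤ (n : ℝ) ^ 2 := by rw [← sq_abs]; nlinarith
  have hx4 : 0 ≤ x ^ 4 := by positivity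
  have hQ1 : 1 ≤ Q := by nlinarith
  have hx1 : x ≤ 1 := by
    by_contra h
    push Not at h
    nlinarith [one_lt_pow₀ h (n := 4) (by norm_num), sq_nonneg S]
  have hb : |b| ≤ 1 := abs_le_one_iff_mul_self_le_one.2 (by nlinarith)
  have hQinv : 0 ≤ 1 - 1 / Q := by
    rw [sub_nonneg, div_le_one (by linarith)]; exact hQ1
  have hxn : |(n : ℝ)| * x ^ 3 ≤ Q := by
    have h1 : x ^ 3 ≤ x ^ 2 := pow_le_pow_of_le_one hx hx1 (by norm_num)
    rcases eq_or_ne |n| 1 with h | h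
    · have h' : |(n : ℝ)| = 1 := by exact_mod_cast h
      nlinarith [pow_le_one₀ hx hx1 (n := 3)]
    · have h2 : (2 : ℝ) ≤ |(n : ℝ)| := by
        have : 2 ≤ |n| := by have := Int.one_le_abs hn; omega
        exact_mod_cast this
      have hQ' : Q = 1 + (|(n : ℝ)| ^ 2 - 1) * x ^ 4 := by rw [sq_abs, hQ]; linarith
      have h3 : |(n : ℝ)| * x ^ 3 ≤ |(n : ℝ)| * x ^ 2 := by gcongr
      nlinarith [sq_nonneg (|(n : ℝ)| * x ^ 2 - 2), sq_nonneg (|(n : ℝ)| * x ^ 2 - 1),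
        mul_nonneg (sub_nonneg.2 h2) hx4]
  -- The offset splits into a part bounded by `a`, and a part that is at most `1 - u`: it vanishes
  -- together with `1 - u` for `n = ± 1`, while `u` is small for `|n| ≥ 2`.
  have hsplit : x * (n * x ^ 2 * a + S * b) / Q - x * S * b
      = n * x ^ 3 / Q * a - x * S * b * (1 - 1 / Q) := by
    field_simp
    ring
  have hfirst : |n * x ^ 3 / Q * a| ≤ a := by
    rw [abs_mul, abs_div, abs_mul, abs_of_nonneg ha, abs_of_nonneg (by positivity : 0 ≤ x ^ 3),
      abs_of_pos (by linarith : 0 < Q)]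
    exact mul_le_of_le_one_left ha ((div_le_one (by linarith)).2 hxn)
  have hsecond : |x * S * b * (1 - 1 / Q)| ≤ 1 - u := by
    rw [abs_mul, abs_of_nonneg hQinv]
    rcases eq_or_ne (n ^ 2) 1 with h | h
    · have h' : (n : ℝ) ^ 2 = 1 := by exact_mod_cast h
      have hQe : Q = 1 := by rw [hQ, h']; linarith
      rw [h', hQe] at huQ
      have : u = 1 := by
        have : u ^ 4 = 1 := by linarith
        exact (pow_eq_one_iff_of_nonneg hu (by norm_num)).1 this
      simp [hQe, this]
    · have h4 : (4 : ℝ) ≤ (n : ℝ) ^ 2 := by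
        have h2 : 2 ≤ |n| := by
          have h1 := Int.one_le_abs hn
          have : |n| ≠ 1 := fun h1 => h (by rw [← sq_abs, h1]; rfl)
          omega
        have : 4 ≤ n ^ 2 := by rw [← sq_abs]; nlinarith
        exact_mod_cast this
      have hxSb : |x * S * b| ≤ 5 / 8 := by
        rw [abs_mul]
        have hxS' : |x * S| ≤ 5 / 8 := by
          refine abs_le_of_sq_le_sq ?_ (by norm_num)
          have : (x * S) ^ 2 = x ^ 2 * (1 - x ^ 4) := by rw [← hxS]; ring
          rw [this]
          -- The maximum of `y - y ^ 3` over `y ≥ 0` is attained at `y = 1 / √3 ≈ 0.577`.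
          nlinarith [sq_nonneg (x ^ 2 - 577 / 1000), sq_nonneg x,
            mul_nonneg (sq_nonneg x) (sq_nonneg (x ^ 2 - 577 / 1000))]
        calc |x * S| * |b| ≤ 5 / 8 * 1 := by gcongr
          _ = 5 / 8 := by norm_num
      have hu4 : 4 * u ^ 4 ≤ 1 / Q := by
        rw [le_div_iff₀ (by linarith)]
        have : 0 ≤ u ^ 4 * Q := by positivity
        nlinarith
      calc |x * S * b| * (1 - 1 / Q) ≤ 5 / 8 * (1 - 4 * u ^ 4) := by
            gcongr
        _ ≤ 1 - u := by
            -- `5 / 2 * u ^ 4 - u + 3 / 8` is positive, with minimum near `u = 0.465`.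
            nlinarith [sq_nonneg (u ^ 2 - 43 / 200), sq_nonneg (u - 93 / 200)]
  rw [hsplit]
  linarith [abs_sub (n * x ^ 3 / Q * a) (x * S * b * (1 - 1 / Q))]

/-! ### One-parameter groups of Heisenberg translations -/

theorem matrixA_mul (s s' θ t t' : ℝ) :
    matrixA s θ t * matrixA s' θ t' = matrixA (s + s') θ (t + t') := by
  have h := sqrt_two_mul_exp 1 θ
  ext i j
  fin_cases i <;> fin_cases j <;>
    simp [matrixA, Matrix.mul_apply, Fin.sum_univ_three]
  · ring
  · push_cast at h
    linear_combination -(s : ℂ) * s' * h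
  · ring

/-- The matrix of the Hermitian form is also the involution that swaps the fixed points `o` and
`∞`; it conjugates `B` to the translation fixing `∞` with the same parameters. -/
theorem matrixB_eq_conj (s θ t : ℝ) : matrixB s θ t = hermitianH * matrixA s θ t * hermitianH := by
  ext i j
  fin_cases i <;> fin_cases j <;>
    simp [matrixA, matrixB, hermitianH, Matrix.mul_apply, Fin.sum_univ_three]

theorem hermitianH_mul_self : hermitianH * hermitianH = 1 := by
  ext i j
  fin_cases i <;> fin_cases j <;>
    simp [hermitianH, Matrix.mul_apply, Fin.sum_univ_three]

theorem matrixA_eq_conj (s θ t : ℝ) : matrixA s θ t = hermitianH * matrixB s θ t * hermitianH := by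
  rw [matrixB_eq_conj]
  simp only [Matrix.mul_assoc, hermitianH_mul_self, mul_one]
  rw [← Matrix.mul_assoc, hermitianH_mul_self, one_mul]

theorem matrixB_mul (s s' θ t t' : ℝ) :
    matrixB s θ t * matrixB s' θ t' = matrixB (s + s') θ (t + t') := by
  simp only [matrixB_eq_conj, ← matrixA_mul, Matrix.mul_assoc]
  rw [← Matrix.mul_assoc hermitianH hermitianH, hermitianH_mul_self, one_mul]

/-- An additive one-parameter family evaluated at `(n s, n t)` is the `n`-th power. -/
theorem zpow_eq_of_mul {G : Type*} [Group G] (F : ℝ → ℝ → G)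
    (hF : ∀ s s' t t', F s t * F s' t' = F (s + s') (t + t')) (s t : ℝ) (n : ℤ) :
    F s t ^ n = F (n * s) (n * t) := by
  let φ : Multiplicative ℤ →* G := MonoidHom.mk' (fun m => F (m.toAdd * s) (m.toAdd * t)) (by
    intro m m'
    simp only [hF, toAdd_mul, Int.cast_add, add_mul])
  have h := map_zpow φ (Multiplicative.ofAdd 1) n
  simp only [← ofAdd_zsmul] at h
  simpa [φ] using h.symm

theorem translationA_zpow (s θ t : ℝ) (n : ℤ) :
    translationA s θ t ^ n = translationA (n * s) θ (n * t) :=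
  zpow_eq_of_mul (fun s t => translationA s θ t)
    (fun s s' t t' => Subtype.ext (Subtype.ext (matrixA_mul s s' θ t t'))) s t n

theorem translationB_zpow (s θ t : ℝ) (n : ℤ) :
    translationB s θ t ^ n = translationB (n * s) θ (n * t) :=
  zpow_eq_of_mul (fun s t => translationB s θ t)
    (fun s s' t t' => Subtype.ext (Subtype.ext (matrixB_mul s s' θ t t'))) s t n

/-! ### Null vectors, Cygan balls and isometric spheres -/

/-- The null vectors of the Hermitian form; those with `z 2 ≠ 0` are the lifts
`(-|ζ|² + i v, √2 ζ, 1)`, up to scaling, of the points `(ζ, v)` of the Heisenberg group. -/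
def IsNull (z : Fin 3 → ℂ) : Prop := star z ⬝ᵥ (hermitianH *ᵥ z) = 0

theorem IsNull.mulVec {M : Matrix (Fin 3) (Fin 3) ℂ} (hM : Mᴴ * hermitianH * M = hermitianH)
    {z : Fin 3 → ℂ} (hz : IsNull z) : IsNull (M *ᵥ z) := by
  unfold IsNull at *
  rw [Matrix.star_mulVec, ← Matrix.dotProduct_mulVec, Matrix.mulVec_mulVec, Matrix.mulVec_mulVec,
    hM, hz]

theorem isNull_iff (z : Fin 3 → ℂ) : IsNull z ↔ 2 * (z 0 * conj (z 2)).re + ‖z 1‖ ^ 2 = 0 := by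
  have h : star z ⬝ᵥ (hermitianH *ᵥ z)
      = ((2 * (z 0 * conj (z 2)).re + ‖z 1‖ ^ 2 : ℝ) : ℂ) := by
    have h1 : ((‖z 1‖ ^ 2 : ℝ) : ℂ) = conj (z 1) * z 1 := by
      rw [← Complex.normSq_eq_norm_sq, Complex.normSq_eq_conj_mul_self]
    rw [Complex.ofReal_add, h1]
    apply Complex.ext <;>
      simp [hermitianH, Matrix.mulVec, dotProduct, Fin.sum_univ_three] <;> ring
  rw [IsNull, h]
  exact_mod_cast Iff.rfl

theorem IsNull.re_eq {z : Fin 3 → ℂ} (hz : IsNull z) (h2 : z 2 ≠ 0) :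
    (-(z 0 / z 2)).re = ‖z 1 / ((√2 : ℂ) * z 2)‖ ^ 2 := by
  rw [isNull_iff] at hz
  have hp : 0 < ‖z 2‖ ^ 2 := by positivity
  have hre : (z 0 / z 2).re = (z 0 * conj (z 2)).re / ‖z 2‖ ^ 2 := by
    rw [div_eq_mul_inv, Complex.inv_def, ← mul_assoc, Complex.re_mul_ofReal,
      Complex.normSq_eq_norm_sq, div_eq_mul_inv]
  have hs : ‖(√2 : ℂ)‖ ^ 2 = 2 := by simp
  rw [Complex.neg_re, hre, norm_div, norm_mul, div_pow, mul_pow, hs]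
  field_simp
  linarith

/-- If `B` comes from the translation by `(β, τ)` and `W = |β|² - i τ`, the right-hand side is the
factor by which `B` scales the last coordinate of the lift of a point over `ζ`. Hence the isometric
sphere of `B`, where this factor is `1`, projects into the disc of radius `‖W‖ ^ (-1/2)` about
`β / conj W`. -/
theorem isometric_disc {ζ Z β W : ℂ} (hZ : Z.re = ‖ζ‖ ^ 2) (hW : W.re = ‖β‖ ^ 2) (hW0 : W ≠ 0) :
    ‖ζ - β / conj W‖ ^ 2 * ‖W‖ ≤ ‖W * Z - 2 * conj β * ζ + 1‖ := by
  -- By the null conditions on `Z` and `W`, completing the square gives an equality of real parts.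
  have h : ‖ζ - β / conj W‖ ^ 2 = ((W * Z - 2 * conj β * ζ + 1) / W).re := by
    have h1 : (W * Z - 2 * conj β * ζ + 1) / W = Z - 2 * (ζ * (conj β / W)) + W⁻¹ := by
      field_simp
    have h2 : conj (β / conj W) = conj β / W := by simp
    rw [h1, ← Complex.normSq_eq_norm_sq, Complex.normSq_sub, h2, Complex.normSq_div,
      Complex.normSq_conj, Complex.normSq_eq_norm_sq β, ← hW, Complex.normSq_eq_norm_sq ζ, ← hZ]
    simp [Complex.inv_re]
    ring
  have hWp : 0 < ‖W‖ := norm_pos_iff.2 hW0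
  rw [h, ← le_div_iff₀ hWp, ← norm_div]
  exact Complex.re_le_norm _

/-- Reverse triangle inequality for the Cygan norm: a translation by an element of squared Cygan
norm at least `4 R` moves the open ball of squared radius `R` off its closure. -/
theorem cygan_lt {ζ Z α W : ℂ} {R : ℝ} (hZ : Z.re = ‖ζ‖ ^ 2) (hW : W.re = ‖α‖ ^ 2)
    (hWR : 4 * R ≤ ‖W‖) (hZR : ‖Z‖ < R) : R < ‖Z + W + 2 * conj α * ζ‖ := by
  set Y := Z + W + 2 * conj α * ζ with hY
  have hYre : Y.re = ‖ζ + α‖ ^ 2 := by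
    rw [← Complex.normSq_eq_norm_sq, Complex.normSq_add, Complex.normSq_eq_norm_sq,
      Complex.normSq_eq_norm_sq, ← hZ, ← hW, hY]
    simp
    ring
  by_contra! hle
  have hζ : ‖ζ‖ ^ 2 < R := by rw [← hZ]; exact (Complex.re_le_norm _).trans_lt hZR
  have hη : ‖ζ + α‖ ^ 2 ≤ R := by rw [← hYre]; exact (Complex.re_le_norm _).trans hle
  -- The translation is the quotient of the image point by the original one.
  have hid : W = Y + conj Z - 2 * (conj (ζ + α) * ζ) := by
    have h1 : Z + conj Z = 2 * (conj ζ * ζ) := by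
      rw [Complex.add_conj, ← Complex.normSq_eq_conj_mul_self, Complex.normSq_eq_norm_sq, ← hZ]
      push_cast; ring
    rw [hY, map_add]
    linear_combination -h1
  have hnorm : ‖W‖ ≤ ‖Y‖ + ‖Z‖ + 2 * (‖ζ + α‖ * ‖ζ‖) := by
    calc ‖W‖ ≤ ‖Y + conj Z‖ + ‖2 * (conj (ζ + α) * ζ)‖ := by
          nth_rewrite 1 [hid]; exact norm_sub_le _ _
      _ ≤ ‖Y‖ + ‖conj Z‖ + ‖2 * (conj (ζ + α) * ζ)‖ := by gcongr; exact norm_add_le _ _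
      _ = _ := by rw [RCLike.norm_conj, norm_mul, norm_mul, RCLike.norm_conj]; simp
  nlinarith [sq_nonneg (‖ζ + α‖ - ‖ζ‖)]

theorem re_ofReal_sq_add_mul_I (x y : ℝ) : ((x : ℂ) ^ 2 + y * Complex.I).re = x ^ 2 := by
  simp [← Complex.ofReal_pow]

theorem im_ofReal_sq_add_mul_I (x y : ℝ) : ((x : ℂ) ^ 2 + y * Complex.I).im = y := by
  simp [← Complex.ofReal_pow]

theorem norm_ofReal_add_mul_I_sq (x y : ℝ) : ‖(x : ℂ) + y * Complex.I‖ ^ 2 = x ^ 2 + y ^ 2 := by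
  rw [← Complex.normSq_eq_norm_sq, Complex.normSq_add_mul_I]

theorem one_le_intCast_sq {n : ℤ} (hn : n ≠ 0) : (1 : ℝ) ≤ (n : ℝ) ^ 2 := by
  have : (1 : ℝ) ≤ |(n : ℝ)| := by exact_mod_cast Int.one_le_abs hn
  rw [← sq_abs]
  nlinarith

/-- The fourth power of the Cygan norm of the `n`-th power of `(s e^{iθ}, t)`. -/
theorem norm_zpow_translation_sq (s t : ℝ) (n : ℤ) :
    ‖((n * s : ℝ) : ℂ) ^ 2 + (n * t : ℝ) * Complex.I‖ ^ 2
      = (n : ℝ) ^ 2 * ((n : ℝ) ^ 2 * s ^ 4 + t ^ 2) := by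
  rw [← Complex.ofReal_pow, norm_ofReal_add_mul_I_sq]
  ring

theorem norm_zpow_translation_pos {s t N : ℝ} {n : ℤ} (hn : n ≠ 0) (hN : 0 < N)
    (hst : s ^ 4 + t ^ 2 = N ^ 4) :
    0 < ‖((n * s : ℝ) : ℂ) ^ 2 + (n * t : ℝ) * Complex.I‖ := by
  have hn2 := one_le_intCast_sq hn
  have h0 : 0 < N ^ 4 := by positivity
  have hs4 : 0 ≤ s ^ 4 := by positivity
  have hsq := norm_zpow_translation_sq s t n
  refine (norm_nonneg _).lt_of_ne fun h => ?_
  rw [← h] at hsq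
  nlinarith [mul_nonneg (sub_nonneg.2 hn2) hs4]

/-- The disc of the isometric sphere of `B ^ n`, rotated so that `A` translates along the real
axis, lies in a strip of half-width `(1 + cos (θ₁ - θ₂)) / N` whose axis does not depend on `n`. -/
theorem isometric_disc_offset_le {s t N θ₁ θ₂ : ℝ} {n : ℤ} (hn : n ≠ 0) (hs : 0 ≤ s) (hN : 0 < N)
    (hst : s ^ 4 + t ^ 2 = N ^ 4) (hcos : 0 ≤ Real.cos (θ₁ - θ₂)) :
    |(Complex.exp (-(θ₁ * Complex.I)) * (((n * s : ℝ) : ℂ) * Complex.exp (θ₂ * Complex.I)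
        / (((n * s : ℝ) : ℂ) ^ 2 + (n * t : ℝ) * Complex.I))).re
        - s * t * Real.sin (θ₂ - θ₁) / N ^ 4|
      + 1 / √‖((n * s : ℝ) : ℂ) ^ 2 + (n * t : ℝ) * Complex.I‖
      ≤ (1 + Real.cos (θ₁ - θ₂)) / N := by
  set W : ℂ := ((n * s : ℝ) : ℂ) ^ 2 + (n * t : ℝ) * Complex.I with hW
  set a := Real.cos (θ₁ - θ₂) with ha
  set b := Real.sin (θ₂ - θ₁) with hb
  have ha' : Real.cos (θ₂ - θ₁) = a := by rw [ha, ← Real.cos_neg, neg_sub]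
  have hn' : (n : ℝ) ≠ 0 := by exact_mod_cast hn
  have hn2 := one_le_intCast_sq hn
  have hP : 0 < (n : ℝ) ^ 2 * s ^ 4 + t ^ 2 := by
    have : 0 < N ^ 4 := by positivity
    nlinarith [pow_nonneg hs 4]
  have hWsq : ‖W‖ ^ 2 = (n : ℝ) ^ 2 * ((n : ℝ) ^ 2 * s ^ 4 + t ^ 2) :=
    norm_zpow_translation_sq s t n
  have hWpos : 0 < ‖W‖ := norm_zpow_translation_pos hn hN hst
  have hcenter : (Complex.exp (-(θ₁ * Complex.I)) * (((n * s : ℝ) : ℂ)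
      * Complex.exp (θ₂ * Complex.I) / W)).re
      = s * (n * s ^ 2 * a + t * b) / ((n : ℝ) ^ 2 * s ^ 4 + t ^ 2) := by
    have h1 : Complex.exp (-(θ₁ * Complex.I)) * (((n * s : ℝ) : ℂ)
        * Complex.exp (θ₂ * Complex.I) / W)
        = ((n * s : ℝ) : ℂ) * ((a : ℂ) + (b : ℂ) * Complex.I) / W := by
      have h2 : Complex.exp (-(θ₁ * Complex.I)) * Complex.exp (θ₂ * Complex.I)
          = (a : ℂ) + (b : ℂ) * Complex.I := by
        rw [← Complex.exp_add, ← ha', hb, Complex.ofReal_cos, Complex.ofReal_sin,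
          ← Complex.exp_mul_I]
        congr 1; push_cast; ring
      rw [← h2]; ring
    have h3 : W = ⟨(n * s) ^ 2, n * t⟩ :=
      Complex.ext (re_ofReal_sq_add_mul_I _ _) (im_ofReal_sq_add_mul_I _ _)
    rw [h1, Complex.div_re, Complex.normSq_eq_norm_sq, hWsq, h3]
    simp [Complex.mul_re, Complex.mul_im]
    field_simp
  have key := isometric_offset_le (x := s / N) (S := t / N ^ 2) (a := a) (b := b)
    (u := N / √‖W‖) hn (by positivity) (by field_simp; linarith) hcos
    (by rw [← ha', hb]; exact Real.cos_sq_add_sin_sq _) (by positivity) (by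
      have : √‖W‖ ^ 4 = ‖W‖ ^ 2 := by
        rw [show √‖W‖ ^ 4 = (√‖W‖ ^ 2) ^ 2 by ring, Real.sq_sqrt hWpos.le]
      rw [div_pow, this, hWsq]
      field_simp)
  have hscale : s * (n * s ^ 2 * a + t * b) / ((n : ℝ) ^ 2 * s ^ 4 + t ^ 2) - s * t * b / N ^ 4
      = (s / N * (n * (s / N) ^ 2 * a + t / N ^ 2 * b)
        / ((n : ℝ) ^ 2 * (s / N) ^ 4 + (t / N ^ 2) ^ 2) - s / N * (t / N ^ 2) * b) / N := by
    have hQ : (n : ℝ) ^ 2 * (s / N) ^ 4 + (t / N ^ 2) ^ 2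
        = ((n : ℝ) ^ 2 * s ^ 4 + t ^ 2) / N ^ 4 := by field_simp
    rw [hQ]
    field_simp
  rw [hcenter, hscale, abs_div, abs_of_pos hN]
  calc _ = (|s / N * (n * (s / N) ^ 2 * a + t / N ^ 2 * b)
        / ((n : ℝ) ^ 2 * (s / N) ^ 4 + (t / N ^ 2) ^ 2) - s / N * (t / N ^ 2) * b|
        + N / √‖W‖) / N := by field_simp
    _ ≤ _ := by gcongr

/-- Distance from the strip axis of the horizontal projection of a null vector, in terms of the
factor by which `B ^ n` scales its last coordinate: inside the isometric sphere of `B ^ n` this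
factor is below `1`, and the projection lies in the strip. -/
theorem strip_offset_le {s t N θ₁ θ₂ : ℝ} {n : ℤ} (hn : n ≠ 0) (hs : 0 ≤ s) (hN : 0 < N)
    (hst : s ^ 4 + t ^ 2 = N ^ 4) (hcos : 0 ≤ Real.cos (θ₁ - θ₂))
    {z : Fin 3 → ℂ} (hz : IsNull z) (h2 : z 2 ≠ 0) :
    |(Complex.exp (-(θ₁ * Complex.I)) * (z 1 / ((√2 : ℂ) * z 2))).re
        - s * t * Real.sin (θ₂ - θ₁) / N ^ 4|
      ≤ (1 + Real.cos (θ₁ - θ₂)) / N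
        + (√(‖(matrixB (n * s) θ₂ (n * t) *ᵥ z) 2‖ / ‖z 2‖) - 1)
          / √‖((n * s : ℝ) : ℂ) ^ 2 + (n * t : ℝ) * Complex.I‖ := by
  have hoff := isometric_disc_offset_le (θ₁ := θ₁) (θ₂ := θ₂) hn hs hN hst hcos
  set V : ℂ := ((n * s : ℝ) : ℂ) ^ 2 + (n * t : ℝ) * Complex.I with hV
  set β : ℂ := ((n * s : ℝ) : ℂ) * Complex.exp (θ₂ * Complex.I) with hβ
  set e := Complex.exp (-(θ₁ * Complex.I)) with he
  set ζ := z 1 / ((√2 : ℂ) * z 2) with hζ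
  set c := s * t * Real.sin (θ₂ - θ₁) / N ^ 4
  have hV0 : V ≠ 0 := norm_pos_iff.1 (norm_zpow_translation_pos hn hN hst)
  have hVp : 0 < √‖V‖ := Real.sqrt_pos.2 (norm_pos_iff.2 hV0)
  have hVre : (conj V).re = ‖β‖ ^ 2 := by
    have h1 : ‖Complex.exp (θ₂ * Complex.I)‖ = 1 := Complex.norm_exp_ofReal_mul_I θ₂
    rw [hβ, norm_mul, h1, Complex.norm_real, mul_one, Real.norm_eq_abs, sq_abs]
    exact (Complex.conj_re V).trans (re_ofReal_sq_add_mul_I _ _)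
  have hdisc := isometric_disc (hz.re_eq h2) hVre
    (by simpa using hV0)
  have hD : ‖conj V * -(z 0 / z 2) - 2 * conj β * ζ + 1‖
      = ‖(matrixB (n * s) θ₂ (n * t) *ᵥ z) 2‖ / ‖z 2‖ := by
    rw [← norm_div]
    congr 1
    have hs2 : (√2 : ℂ) * (√2 : ℂ) = 2 := by rw [← Complex.ofReal_mul]; simp
    have hs0 : (√2 : ℂ) ≠ 0 := by intro h; simp [h] at hs2
    rw [hζ, hβ, hV, map_mul, conj_exp_mul_I]
    generalize hE : Complex.exp (-(θ₂ * Complex.I)) = E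
    simp [matrixB, Matrix.mulVec, dotProduct, Fin.sum_univ_three, hE]
    field_simp
    linear_combination ((n : ℂ) * s * z 1 * E) * hs2
  rw [← hζ, hD, Complex.conj_conj, RCLike.norm_conj] at hdisc
  set d := ‖(matrixB (n * s) θ₂ (n * t) *ᵥ z) 2‖ / ‖z 2‖
  have hdist : ‖ζ - β / V‖ ≤ √d / √‖V‖ := by
    rw [le_div_iff₀ hVp]
    apply Real.le_sqrt_of_sq_le
    rw [mul_pow, Real.sq_sqrt (norm_nonneg _)]
    exact hdisc
  have hre : |(e * ζ).re - (e * (β / V)).re| ≤ ‖ζ - β / V‖ := by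
    have he1 : ‖e‖ = 1 := by
      rw [he, ← neg_mul, ← Complex.ofReal_neg]
      exact Complex.norm_exp_ofReal_mul_I _
    rw [← Complex.sub_re, ← mul_sub]
    refine (Complex.abs_re_le_norm _).trans ?_
    rw [norm_mul, he1, one_mul]
  have htri := abs_sub_le (e * ζ).re (e * (β / V)).re c
  rw [sub_div]
  linarith

/-! ### Ping-pong on null vectors -/

/-- Ping-pong data for the translations `A` and `B`: disjoint open sets `U` and `V` of vectors such
that, on null vectors, all nontrivial powers of `A` map `U` into `V` and all nontrivial powers of
`B` map `V` into `U`. -/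
def HasPingPong (s₁ θ₁ t₁ s₂ θ₂ t₂ : ℝ) : Prop :=
  ∃ U V : Set (Fin 3 → ℂ), IsOpen U ∧ IsOpen V ∧ Disjoint U V ∧ (∃ z ∈ U, IsNull z) ∧
    (∀ n : ℤ, n ≠ 0 → ∀ z ∈ U, IsNull z → matrixA (n * s₁) θ₁ (n * t₁) *ᵥ z ∈ V) ∧
    (∀ n : ℤ, n ≠ 0 → ∀ z ∈ V, IsNull z → matrixB (n * s₂) θ₂ (n * t₂) *ᵥ z ∈ U)

theorem hermitianH_unitary : hermitianHᴴ * hermitianH * hermitianH = hermitianH := by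
  rw [Matrix.mul_assoc, hermitianH_mul_self, mul_one]
  ext i j
  fin_cases i <;> fin_cases j <;> simp [hermitianH]

/-- The involution that swaps the two fixed points `o` and `∞` exchanges the roles of the two
translations. -/
theorem HasPingPong.symm {s₁ θ₁ t₁ s₂ θ₂ t₂ : ℝ} (h : HasPingPong s₁ θ₁ t₁ s₂ θ₂ t₂) :
    HasPingPong s₂ θ₂ t₂ s₁ θ₁ t₁ := by
  obtain ⟨U, V, hU, hV, hd, ⟨z₀, hz₀, hn₀⟩, hA, hB⟩ := h
  have hcont : Continuous fun z : Fin 3 → ℂ => hermitianH *ᵥ z := by fun_prop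
  have hJ : ∀ z : Fin 3 → ℂ, hermitianH *ᵥ (hermitianH *ᵥ z) = z := fun z => by
    rw [Matrix.mulVec_mulVec, hermitianH_mul_self, Matrix.one_mulVec]
  refine ⟨(hermitianH *ᵥ ·) ⁻¹' V, (hermitianH *ᵥ ·) ⁻¹' U, hV.preimage hcont, hU.preimage hcont,
    (hd.preimage _).symm, ⟨hermitianH *ᵥ (matrixA ((1 : ℤ) * s₁) θ₁ ((1 : ℤ) * t₁) *ᵥ z₀), ?_,
      (hn₀.mulVec (matrixA_unitary _ _ _)).mulVec hermitianH_unitary⟩, ?_, ?_⟩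
  · rw [Set.mem_preimage, hJ]
    exact hA 1 one_ne_zero z₀ hz₀ hn₀
  · intro n hn z hz hz0
    rw [Set.mem_preimage, matrixA_eq_conj, Matrix.mul_assoc, ← Matrix.mulVec_mulVec, hJ,
      ← Matrix.mulVec_mulVec]
    exact hB n hn _ hz (hz0.mulVec hermitianH_unitary)
  · intro n hn z hz hz0
    rw [Set.mem_preimage, matrixB_eq_conj, Matrix.mul_assoc, ← Matrix.mulVec_mulVec, hJ,
      ← Matrix.mulVec_mulVec]
    exact hA n hn _ hz (hz0.mulVec hermitianH_unitary)

theorem HasPingPong.discrete_and_free {s₁ θ₁ t₁ s₂ θ₂ t₂ : ℝ}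
    (h : HasPingPong s₁ θ₁ t₁ s₂ θ₂ t₂) :
    DiscreteTopology
        (Subgroup.closure {translationA s₁ θ₁ t₁, translationB s₂ θ₂ t₂} : Subgroup SU21) ∧
      Function.Injective
        (FreeGroup.lift ![translationA s₁ θ₁ t₁, translationB s₂ θ₂ t₂] :
          FreeGroup (Fin 2) →* SU21) := by
  obtain ⟨U, V, hU, hV, hd, ⟨z₀, hz₀, hn₀⟩, hA, hB⟩ := h
  have hsmul : ∀ (g : SU21) (z : Fin 3 → ℂ),
      g • z = ((g : Matrix.SpecialLinearGroup (Fin 3) ℂ) : Matrix (Fin 3) (Fin 3) ℂ) *ᵥ z :=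
    fun _ _ => rfl
  have hnull : ∀ (g : SU21) {z : Fin 3 → ℂ}, IsNull z → IsNull (g • z) :=
    fun g _ hz => hz.mulVec g.2
  have hopen : ∀ O : Set (Fin 3 → ℂ), IsOpen O → ∀ x ∈ O ∩ {z | IsNull z},
      ∀ᶠ g in nhds (1 : SU21), g • x ∈ O ∩ {z | IsNull z} := by
    rintro O hO x ⟨hx, hx0⟩
    have hc : Continuous fun g : SU21 => g • x := by
      have hval : Continuous fun g : SU21 =>
          ((g : Matrix.SpecialLinearGroup (Fin 3) ℂ) : Matrix (Fin 3) (Fin 3) ℂ) :=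
        continuous_subtype_val.comp continuous_subtype_val
      exact hval.matrix_mulVec continuous_const
    have := hc.continuousAt.preimage_mem_nhds (x := 1) (hO.mem_nhds (by simpa using hx))
    filter_upwards [this] with g hg
    exact ⟨hg, hnull g hx0⟩
  have hAV : ∀ n : ℤ, n ≠ 0 → ∀ z ∈ U ∩ {z | IsNull z},
      translationA s₁ θ₁ t₁ ^ n • z ∈ V ∩ {z | IsNull z} := by
    rintro n hn z ⟨hz, hz0⟩
    refine ⟨?_, hnull _ hz0⟩
    rw [translationA_zpow]
    exact hA n hn z hz hz0
  have hBU : ∀ n : ℤ, n ≠ 0 → ∀ z ∈ V ∩ {z | IsNull z},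
      translationB s₂ θ₂ t₂ ^ n • z ∈ U ∩ {z | IsNull z} := by
    rintro n hn z ⟨hz, hz0⟩
    refine ⟨?_, hnull _ hz0⟩
    rw [translationB_zpow]
    exact hB n hn z hz hz0
  have hd' : Disjoint (V ∩ {z | IsNull z}) (U ∩ {z | IsNull z}) :=
    hd.symm.mono Set.inter_subset_left Set.inter_subset_left
  have key := discrete_and_free_of_ping_pong ![translationA s₁ θ₁ t₁, translationB s₂ θ₂ t₂]
    ![V ∩ {z | IsNull z}, U ∩ {z | IsNull z}]
    (by
      intro i
      fin_cases i
      · exact ⟨_, hAV 1 one_ne_zero z₀ ⟨hz₀, hn₀⟩⟩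
      · exact ⟨z₀, hz₀, hn₀⟩)
    (by
      intro i j hij
      fin_cases i <;> fin_cases j
      · exact absurd rfl hij
      · exact hd'
      · exact hd'.symm
      · exact absurd rfl hij)
    (by
      intro i j hij
      fin_cases i <;> fin_cases j
      · exact absurd rfl hij
      · exact hAV
      · exact hBU
      · exact absurd rfl hij)
    (by
      intro i
      fin_cases i
      · exact hopen V hV
      · exact hopen U hU)
  have hr : Set.range ![translationA s₁ θ₁ t₁, translationB s₂ θ₂ t₂]
      = {translationA s₁ θ₁ t₁, translationB s₂ θ₂ t₂} := by
    rw [Matrix.range_cons, Matrix.range_cons, Matrix.range_empty, Set.union_empty]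
    rfl
  rwa [hr] at key

/-- Nontrivial powers of `A` move an open Cygan ball about `o` off its closure as soon as the
squared Cygan norm of the translation is at least four times the squared radius. -/
theorem matrixA_mulVec_ball {s θ t R : ℝ} (hR : 4 * R ≤ ‖(s : ℂ) ^ 2 + t * Complex.I‖) {n : ℤ}
    (hn : n ≠ 0) {z : Fin 3 → ℂ} (hz : IsNull z) (hzR : ‖z 0‖ < R * ‖z 2‖) :
    R * ‖(matrixA (n * s) θ (n * t) *ᵥ z) 2‖ < ‖(matrixA (n * s) θ (n * t) *ᵥ z) 0‖ := by
  have h2 : z 2 ≠ 0 := by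
    intro h
    rw [h, norm_zero, mul_zero] at hzR
    exact absurd hzR (not_lt.2 (norm_nonneg _))
  have hp : 0 < ‖z 2‖ := norm_pos_iff.2 h2
  set α : ℂ := ((n * s : ℝ) : ℂ) * Complex.exp (θ * Complex.I) with hα
  set W : ℂ := ((n * s : ℝ) : ℂ) ^ 2 + (-(n * t) : ℝ) * Complex.I with hW
  have hWre : W.re = ‖α‖ ^ 2 := by
    rw [hα, norm_mul, Complex.norm_exp_ofReal_mul_I, Complex.norm_real, mul_one, Real.norm_eq_abs,
      sq_abs]
    exact re_ofReal_sq_add_mul_I _ _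
  have hn2 := one_le_intCast_sq hn
  have hWR : 4 * R ≤ ‖W‖ := by
    refine hR.trans (abs_le_of_sq_le_sq' ?_ (norm_nonneg _)).2
    rw [hW, ← Complex.ofReal_pow, ← Complex.ofReal_pow, norm_ofReal_add_mul_I_sq,
      norm_ofReal_add_mul_I_sq]
    have h4 : (1 : ℝ) ≤ (n : ℝ) ^ 4 := by nlinarith
    have hs4 : 0 ≤ s ^ 4 := by positivity
    nlinarith [sq_nonneg t]
  have hZR : ‖-(z 0 / z 2)‖ < R := by
    rw [norm_neg, norm_div, div_lt_iff₀ hp]; exact hzR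
  have key := cygan_lt (hz.re_eq h2) hWre hWR hZR
  have hA2 : (matrixA (n * s) θ (n * t) *ᵥ z) 2 = z 2 := by
    simp [matrixA, Matrix.mulVec, dotProduct, Fin.sum_univ_three]
  have hA0 : -(z 0 / z 2) + W + 2 * conj α * (z 1 / ((√2 : ℂ) * z 2))
      = -((matrixA (n * s) θ (n * t) *ᵥ z) 0 / z 2) := by
    have hs2 : (√2 : ℂ) * (√2 : ℂ) = 2 := by rw [← Complex.ofReal_mul]; simp
    have hs0 : (√2 : ℂ) ≠ 0 := by intro h; simp [h] at hs2
    rw [hα, hW, map_mul, conj_exp_mul_I]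
    generalize hE : Complex.exp (-(θ * Complex.I)) = E
    simp [matrixA, Matrix.mulVec, dotProduct, Fin.sum_univ_three, hE]
    field_simp
    linear_combination -((n : ℂ) * s * z 1 * E) * hs2
  rw [hA0, norm_neg, norm_div, lt_div_iff₀ hp] at key
  rwa [hA2]

/-- Ping-pong with a Cygan ball about the fixed point of `B` and its exterior. -/
theorem hasPingPong_of_ball {s₁ θ₁ t₁ s₂ θ₂ t₂ : ℝ}
    (h : 16 ≤ ‖(s₁ : ℂ) ^ 2 + t₁ * Complex.I‖ * ‖(s₂ : ℂ) ^ 2 + t₂ * Complex.I‖) :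
    HasPingPong s₁ θ₁ t₁ s₂ θ₂ t₂ := by
  set K := ‖(s₁ : ℂ) ^ 2 + t₁ * Complex.I‖ with hK
  have hKpos : 0 < K := by
    refine (norm_nonneg _).lt_of_ne fun h0 => ?_
    rw [hK, ← h0] at h
    norm_num at h
  refine ⟨{z | ‖z 0‖ < K / 4 * ‖z 2‖}, {z | K / 4 * ‖z 2‖ < ‖z 0‖},
    isOpen_lt (by fun_prop) (by fun_prop), isOpen_lt (by fun_prop) (by fun_prop), ?_, ?_, ?_, ?_⟩
  · exact Set.disjoint_left.2 fun z hz hz' => lt_asymm (Set.mem_ofPred.1 hz) hz'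
  · refine ⟨![0, 0, 1], ?_, (isNull_iff _).2 (by simp)⟩
    simpa using hKpos
  · intro n hn z hz hz0
    exact matrixA_mulVec_ball (by linarith) hn hz0 hz
  · intro n hn z hz hz0
    -- After swapping `o` and `∞`, the exterior of the ball is the ball of inverse radius.
    have hJ0 : ∀ z : Fin 3 → ℂ, (hermitianH *ᵥ z) 0 = z 2 := fun z => by
      simp [hermitianH, Matrix.mulVec, dotProduct, Fin.sum_univ_three]
    have hJ2 : ∀ z : Fin 3 → ℂ, (hermitianH *ᵥ z) 2 = z 0 := fun z => by
      simp [hermitianH, Matrix.mulVec, dotProduct, Fin.sum_univ_three]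
    have hR : 4 * (4 / K) ≤ ‖(s₂ : ℂ) ^ 2 + t₂ * Complex.I‖ := by
      rw [← mul_div_assoc, div_le_iff₀ hKpos]; linarith
    have hz' : K / 4 * ‖z 2‖ < ‖z 0‖ := hz
    have key := matrixA_mulVec_ball (θ := θ₂) hR hn (hz0.mulVec hermitianH_unitary)
      (by rw [hJ0, hJ2, div_mul_eq_mul_div, lt_div_iff₀ hKpos]; linarith)
    rw [Set.mem_ofPred, matrixB_eq_conj, Matrix.mul_assoc, ← Matrix.mulVec_mulVec, hJ0, hJ2,
      ← Matrix.mulVec_mulVec]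
    rw [div_mul_eq_mul_div, div_lt_iff₀ hKpos] at key
    linarith

/-- Ping-pong with a strip transverse to the horizontal translation direction of `A`, which
contains the isometric spheres of all nontrivial powers of `B`. -/
theorem hasPingPong_of_strip {s₁ θ₁ t₁ s₂ θ₂ t₂ N : ℝ} (hs₁ : 0 < s₁) (hs₂ : 0 ≤ s₂) (hN : 0 < N)
    (hst : s₂ ^ 4 + t₂ ^ 2 = N ^ 4) (hcos : 0 ≤ Real.cos (θ₁ - θ₂))
    (h : 2 * (1 + Real.cos (θ₁ - θ₂)) ≤ s₁ * N) : HasPingPong s₁ θ₁ t₁ s₂ θ₂ t₂ := by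
  -- `c` is the position of the axis of the strip, `x` the coordinate along the direction of `A`.
  set c := s₂ * t₂ * Real.sin (θ₂ - θ₁) / N ^ 4 with hc
  set x : (Fin 3 → ℂ) → ℝ := fun z =>
    (Complex.exp (-(θ₁ * Complex.I)) * (z 1 / ((√2 : ℂ) * z 2))).re with hx
  have hwidth : (1 + Real.cos (θ₁ - θ₂)) / N ≤ s₁ / 2 := by
    rw [div_le_iff₀ hN]; linarith
  have hs2 : (√2 : ℂ) ≠ 0 := by simp
  have hexp : Complex.exp (-(θ₁ * Complex.I)) * Complex.exp (θ₁ * Complex.I) = 1 := by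
    rw [← Complex.exp_add]; simp
  have hO : IsOpen {z : Fin 3 → ℂ | z 2 ≠ 0} := isOpen_ne_fun (by fun_prop) (by fun_prop)
  have hcont : ContinuousOn (fun z => |x z - c|) {z : Fin 3 → ℂ | z 2 ≠ 0} := by
    refine ((Complex.continuous_re.comp_continuousOn (continuousOn_const.mul
      (ContinuousOn.div (by fun_prop) (by fun_prop) ?_))).sub continuousOn_const).abs
    exact fun z hz => mul_ne_zero hs2 hz
  have hW : ∀ n : ℤ, n ≠ 0 →
      0 < √‖((n * s₂ : ℝ) : ℂ) ^ 2 + (n * t₂ : ℝ) * Complex.I‖ :=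
    fun n hn => Real.sqrt_pos.2 (norm_zpow_translation_pos hn hN hst)
  refine ⟨{z | z 2 ≠ 0} ∩ {z | |x z - c| < s₁ / 2}, {z | z 2 ≠ 0} ∩ {z | s₁ / 2 < |x z - c|},
    hcont.isOpen_inter_preimage hO isOpen_Iio, hcont.isOpen_inter_preimage hO isOpen_Ioi,
    ?_, ?_, ?_, ?_⟩
  · exact Set.disjoint_left.2 fun z hz hz' => lt_asymm (Set.mem_ofPred.1 hz.2) hz'.2
  · refine ⟨![-(c : ℂ) ^ 2, (√2 : ℂ) * (c * Complex.exp (θ₁ * Complex.I)), 1],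
      ⟨by simp, ?_⟩, (isNull_iff _).2 ?_⟩
    · have : Complex.exp (-(θ₁ * Complex.I)) * (c * Complex.exp (θ₁ * Complex.I)) = c := by
        linear_combination (c : ℂ) * hexp
      have hxc : x ![-(c : ℂ) ^ 2, (√2 : ℂ) * (c * Complex.exp (θ₁ * Complex.I)), 1] = c := by
        simp only [hx, Matrix.cons_val, mul_one, mul_div_cancel_left₀ _ hs2, this,
          Complex.ofReal_re]
      rw [Set.mem_ofPred, hxc, sub_self, abs_zero]
      exact half_pos hs₁
    · simp [mul_pow, ← Complex.ofReal_pow, Complex.norm_exp_ofReal_mul_I]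
  · rintro n hn z ⟨hz2, hz⟩ hz0
    have hA2 : (matrixA (n * s₁) θ₁ (n * t₁) *ᵥ z) 2 = z 2 := by
      simp [matrixA, Matrix.mulVec, dotProduct, Fin.sum_univ_three]
    have hA1 : x (matrixA (n * s₁) θ₁ (n * t₁) *ᵥ z) = x z + n * s₁ := by
      have h2 : z 2 ≠ 0 := hz2
      have h1 : Complex.exp (-(θ₁ * Complex.I)) * ((matrixA (n * s₁) θ₁ (n * t₁) *ᵥ z) 1
          / ((√2 : ℂ) * z 2)) = Complex.exp (-(θ₁ * Complex.I)) * (z 1 / ((√2 : ℂ) * z 2))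
            + ((n * s₁ : ℝ) : ℂ) := by
        simp only [matrixA, Matrix.mulVec, dotProduct, Fin.sum_univ_three, Matrix.of_apply,
          Matrix.cons_val]
        generalize Complex.exp (-(θ₁ * Complex.I)) = E' at *
        generalize Complex.exp (θ₁ * Complex.I) = E at *
        field_simp
        push_cast
        linear_combination ((√2 : ℂ) * z 2 * n * s₁) * hexp
      simp only [hx, hA2, h1, Complex.add_re, Complex.ofReal_re]
    refine ⟨by rw [Set.mem_ofPred, hA2]; exact hz2, ?_⟩
    have hz' : |x z - c| < s₁ / 2 := hz
    rw [Set.mem_ofPred, hA1]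
    have hn1 : (1 : ℝ) ≤ |(n : ℝ)| := by exact_mod_cast Int.one_le_abs hn
    have hshift : s₁ ≤ |(n : ℝ) * s₁| := by
      rw [abs_mul, abs_of_pos hs₁]; nlinarith
    have htri := abs_sub_abs_le_abs_sub ((n : ℝ) * s₁) (-(x z - c))
    rw [abs_neg, sub_neg_eq_add] at htri
    rw [show x z + n * s₁ - c = n * s₁ + (x z - c) by ring]
    linarith
  · rintro n hn z ⟨hz2, hz⟩ hz0
    have h2 : z 2 ≠ 0 := hz2
    have hp : 0 < ‖z 2‖ := norm_pos_iff.2 h2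
    have hz' : s₁ / 2 < |x z - c| := hz
    set q := matrixB (n * s₂) θ₂ (n * t₂) *ᵥ z with hq
    -- A null vector outside the strip lies outside the isometric sphere of `B ^ n` …
    have hout : ‖z 2‖ < ‖q 2‖ := by
      by_contra! hle
      have key := strip_offset_le (θ₁ := θ₁) (θ₂ := θ₂) hn hs₂ hN hst hcos hz0 h2
      have hd : √(‖q 2‖ / ‖z 2‖) ≤ 1 := by
        
        rw [Real.sqrt_le_iff, one_pow]
        exact ⟨zero_le_one, (div_le_one hp).2 hle⟩
      have hneg : (√(‖q 2‖ / ‖z 2‖) - 1)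
          / √‖((n * s₂ : ℝ) : ℂ) ^ 2 + (n * t₂ : ℝ) * Complex.I‖ ≤ 0 :=
        div_nonpos_of_nonpos_of_nonneg (by linarith) (hW n hn).le
      exact absurd hz' (not_lt.2 (by linarith))
    -- … so its image lies inside the isometric sphere of `B ^ (-n)`.
    have hqp : 0 < ‖q 2‖ := hp.trans hout
    have hq2 : q 2 ≠ 0 := norm_pos_iff.1 hqp
    refine ⟨hq2, ?_⟩
    have hback : matrixB ((-n : ℤ) * s₂) θ₂ ((-n : ℤ) * t₂) *ᵥ q = z := by
      rw [hq, Matrix.mulVec_mulVec, matrixB_mul]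
      have h0 : matrixB 0 θ₂ 0 = 1 := by
        ext i j
        fin_cases i <;> fin_cases j <;> simp [matrixB]
      simp [h0]
    have key := strip_offset_le (θ₁ := θ₁) (θ₂ := θ₂) (neg_ne_zero.2 hn) hs₂ hN hst hcos
      (hz0.mulVec (matrixB_unitary _ _ _)) hq2
    rw [← hq, hback] at key
    have hd : √(‖z 2‖ / ‖q 2‖) < 1 := by
      rw [Real.sqrt_lt' one_pos, one_pow]; exact (div_lt_one hqp).2 hout
    have hneg := div_neg_of_neg_of_pos (sub_neg.2 hd) (hW (-n) (neg_ne_zero.2 hn))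
    change |x q - c| < s₁ / 2
    linarith

/-! ### Groups generated by two Heisenberg translations -/

theorem theorem1p4
    (s₁ θ₁ t₁ s₂ θ₂ t₂ : ℝ)
    (hs₁ : 0 ≤ s₁) (hs₂ : 0 ≤ s₂)
    (hp₁ : Heisenberg.polar s₁ θ₁ t₁ ≠ 1)
    (hp₂ : Heisenberg.polar s₂ θ₂ t₂ ≠ 1)
    (hθ : -(Real.pi / 2) ≤ θ₁ - θ₂ ∧ θ₁ - θ₂ ≤ Real.pi / 2)
    (hcond :
      (4 ≤ ‖(s₁ : ℂ) ^ 2 + t₁ * Complex.I‖ ^ (1 / 2 : ℝ)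
          * ‖(s₂ : ℂ) ^ 2 + t₂ * Complex.I‖ ^ (1 / 2 : ℝ)) ∨
      (s₁ ≠ 0 ∧ 4 * Real.cos ((θ₁ - θ₂) / 2) ^ 2 ≤
          s₁ * ‖(s₂ : ℂ) ^ 2 + t₂ * Complex.I‖ ^ (1 / 2 : ℝ)) ∨
      (s₂ ≠ 0 ∧ 4 * Real.cos ((θ₁ - θ₂) / 2) ^ 2 ≤
          ‖(s₁ : ℂ) ^ 2 + t₁ * Complex.I‖ ^ (1 / 2 : ℝ) * s₂)) :
    DiscreteTopology
        (Subgroup.closure {translationA s₁ θ₁ t₁, translationB s₂ θ₂ t₂} : Subgroup SU21) ∧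
      Function.Injective
        (FreeGroup.lift ![translationA s₁ θ₁ t₁, translationB s₂ θ₂ t₂] :
          FreeGroup (Fin 2) →* SU21) := by

  have hcos : 0 ≤ Real.cos (θ₁ - θ₂) := Real.cos_nonneg_of_neg_pi_div_two_le_of_le hθ.1 hθ.2
  have hhalf : 4 * Real.cos ((θ₁ - θ₂) / 2) ^ 2 = 2 * (1 + Real.cos (θ₁ - θ₂)) := by
    rw [Real.cos_sq, mul_div_cancel₀ _ (two_ne_zero)]; ring
  have hroot : ∀ s t : ℝ, (‖(s : ℂ) ^ 2 + t * Complex.I‖ ^ (1 / 2 : ℝ)) ^ 2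
      = ‖(s : ℂ) ^ 2 + t * Complex.I‖ := fun s t => by
    rw [← Real.sqrt_eq_rpow, Real.sq_sqrt (norm_nonneg _)]
  have hnn : ∀ s t : ℝ, 0 ≤ ‖(s : ℂ) ^ 2 + t * Complex.I‖ ^ (1 / 2 : ℝ) := fun s t => by
    positivity
  have hfour : ∀ s t : ℝ, s ^ 4 + t ^ 2 = (‖(s : ℂ) ^ 2 + t * Complex.I‖ ^ (1 / 2 : ℝ)) ^ 4 :=
    fun s t => by
      have h := norm_ofReal_add_mul_I_sq (s ^ 2) t
      rw [Complex.ofReal_pow, ← hroot] at h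
      linarith
  refine HasPingPong.discrete_and_free ?_
  rcases hcond with h | ⟨h0, h⟩ | ⟨h0, h⟩
  · refine hasPingPong_of_ball ?_
    rw [← hroot s₁, ← hroot s₂, ← mul_pow]
    nlinarith
  · have hs : 0 < s₁ := hs₁.lt_of_ne' h0
    rw [hhalf] at h
    refine hasPingPong_of_strip hs hs₂ ?_ (hfour s₂ t₂) hcos h
    exact pos_of_mul_pos_right (by linarith) hs.le
  · have hs : 0 < s₂ := hs₂.lt_of_ne' h0
    have hcos' : Real.cos (θ₂ - θ₁) = Real.cos (θ₁ - θ₂) := by rw [← Real.cos_neg, neg_sub]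
    rw [hhalf, ← hcos', mul_comm _ s₂] at h
    refine (hasPingPong_of_strip hs hs₁ ?_ (hfour s₁ t₁) (hcos' ▸ hcos) h).symm
    exact pos_of_mul_pos_right (by linarith [hcos' ▸ hcos]) hs.le
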